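/- Let $N\ge 1$ and $X_N=\{0,1,\dots,N-1\}$. For a map $f:X_N\to X_N$, call two points equivalent if some iterate of one lies in the forward orbit of the other; the equivalence classes are the components of $f$. Each component contains exactly one cycle, and the order of the component is the length of that cycle. If the components, listed in increasing order of their least elements, have orders $\omega_1,\dots,\omega_p$, then the finite sequence $[\omega_1,\dots,\omega_p]_N$ is called the global orbit pattern of $f$. For a sequence $A$ of positive integers let $\overline{A}$ be the set of all maps $f:X_N\to X_N$ whose global orbit pattern is $A$, let $\sharp\overline{A}$ be its cardinality, and let $[1_{\widetilde m}]_N$ denote the sequence consisting of $m$ ones. Let $p\ge 2$, let $[\omega_1,\dots,\omega_p]_N$ be the global orbit pattern of some map $X_N\to X_N$, and put $m=\omega_1+\dots+\omega_p$. Then $$\sharp\overline{[\omega_1,\dots,\omega_p]}_N=\sharp\overline{[1_{\widetilde m}]}_N\cdot\frac{(m-1)!}{\prod_{k=2}^{p}\left(\omega_k+\dots+\omega_p\right)}$$ and $$\sharp\overline{[\omega_1,\dots,\omega_p]}_N=\frac{(N-1)!\,N^{N-m}}{(N-m)!\,\prod_{k=2}^{p}\left(\omega_k+\dots+\omega_p\right)}.$$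 -/

import Mathlib

namespace GlobalOrbitPattern

/-- The orbit `O(x, f) = {f^i(x) : i ≥ 0}`. -/
def orbit {X : Type*} (f : X → X) (x : X) : Set X :=
  {y | ∃ i : ℕ, f^[i] x = y}

/-- The order `ω(x, f)`: the least `q ≥ 1` such that the sequence of iterates of `x` is eventually
periodic with period `q`, i.e. the length of the cycle that the orbit of `x` ends in.
(On a finite set such a `q` always exists; for a periodic point it is its minimal period.) -/
noncomputable def order {X : Type*} (f : X → X) (x : X) : ℕ :=
  sInf {q : ℕ | 1 ≤ q ∧ ∃ K : ℕ, ∀ k ≥ K, f^[k + q] x = f^[k] x}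

/-- The relation `x ∼ x'` iff some iterate of `x` lies in the orbit of `x'`. -/
def componentSetoid {X : Type*} (f : X → X) : Setoid X where
  r x x' := ∃ k : ℕ, f^[k] x ∈ orbit f x'
  iseqv :=
    { refl := fun x => ⟨0, 0, rfl⟩
      symm := by
        rintro x y ⟨k, i, h⟩
        exact ⟨i, k, h.symm⟩
      trans := by
        rintro x y z ⟨k, i, h⟩ ⟨k', i', h'⟩
        refine ⟨k' + k, i + i', ?_⟩
        rw [Function.iterate_add_apply, Function.iterate_add_apply, h', ← h,
          ← Function.iterate_add_apply, ← Function.iterate_add_apply, Nat.add_comm] }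

/-- The component of `x` under `f`: the equivalence class of `x`. -/
def component {X : Type*} (f : X → X) (x : X) : Set X :=
  {y | componentSetoid f y x}

open Classical in
/-- The representatives of the components: the points that are the least element of their
component. -/
noncomputable def representatives {N : ℕ} (f : Fin N → Fin N) : Finset (Fin N) :=
  Finset.univ.filter fun x => IsLeast (component f x) x

/-- The global orbit pattern of `f`: the orders of the components of `f`, listed in increasing order
of the least elements of the components. -/
noncomputable def gop {N : ℕ} (f : Fin N → Fin N) : List ℕ :=
  ((representatives f).sort (· ≤ ·)).map (order f)

/-- The set of all global orbit patterns of maps from `X_N = {0, …, N-1}` to itself. -/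
def gops (N : ℕ) : Set (List ℕ) :=
  Set.range (gop (N := N))

/-- The class of a pattern `A`: the maps from `X_N` to itself whose global orbit pattern is `A`. -/
def gopClass (N : ℕ) (A : List ℕ) : Set (Fin N → Fin N) :=
  {f | gop f = A}

end GlobalOrbitPattern

/-!
Every map `f` of a finite set into itself factors uniquely as `σ ∘ g`, where `R` is the set of
periodic points of `f`, `g` is the parent map of a rooted forest with root set `R`, and `σ` is a
permutation of `R` (`exists_comp_eq`, `comp_injective`). The components of `f` are the unions of the
trees whose roots lie on a common cycle of `σ`, and the order of a component is the length of that
cycle. So the global orbit pattern of `f` lists the cycle lengths of `σ` in the order in which the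
roots of `0, 1, …, N - 1` visit the cycles (`gop_comp`).

For a fixed forest the number of `σ` with cycle lengths `ω` in order of first visit does not depend
on the forest (`card_permsOn_cycleLengths`). Removing the first visited point from its cycle gives a
recursion for this number `c(ω)`, and `c(ω) * ∏ₖ (ωₖ + ⋯ + ωₚ) = m!` with `m = ω₁ + ⋯ + ωₚ`
(`cycleCount_mul_tailProd`). The forests with `m` given roots on `N` points number
`m * N ^ (N - m - 1)` (`card_forests_mul`), by induction on the number of non-roots after
deleting the roots. Hence a class has `N.choose m * m * N ^ (N - m - 1) * c(ω)` elements
(`ncard_gopClass_mul`), and comparing with `c(1, …, 1) = 1` gives both formulas.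
-/

namespace GlobalOrbitPattern

/-! ### First representatives of the classes met by a list -/

open Classical in
/-- The sublist of `l` that keeps an element exactly when it is related by `r` to no earlier kept
element. For an equivalence relation this picks the first element of each class, in the order in
which `l` meets the classes. -/
noncomputable def firstReps {α : Type*} (r : α → α → Prop) : List α → List α
  | [] => []
  | x :: l => x :: firstReps r (l.filter fun y => ¬ r x y)
  termination_by l => l.length
  decreasing_by
    rw [List.length_cons, List.length_unattach]
    exact Nat.lt_succ_of_le ((List.length_filter_le _ _).trans_eq List.length_attach)

theorem firstReps_cons {α : Type*} (r : α → α → Prop) [DecidableRel r] (x : α) (l : List α) :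
    firstReps r (x :: l) = x :: firstReps r (l.filter fun y => ¬ r x y) := by
  rw [firstReps]
  congr!

theorem firstReps_congr {α : Type*} {r r' : α → α → Prop} (l : List α)
    (h : ∀ a ∈ l, ∀ b ∈ l, (r a b ↔ r' a b)) : firstReps r l = firstReps r' l := by
  classical
  match l with
  | [] => simp [firstReps]
  | x :: l =>
    have e : l.filter (fun y => ¬ r x y) = l.filter (fun y => ¬ r' x y) :=
      List.filter_congr fun y hy => by simp [h x (by simp) y (by simp [hy])]
    simp only [firstReps]
    rw [← e, firstReps_congr (l.filter fun y => ¬ r x y)]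
    intro a ha b hb
    exact h a (List.mem_cons_of_mem _ (List.mem_of_mem_filter ha)) b
      (List.mem_cons_of_mem _ (List.mem_of_mem_filter hb))
  termination_by l.length
  decreasing_by
    exact Nat.lt_succ_of_le (List.length_filter_le _ _)

theorem firstReps_map {α β : Type*} (r : β → β → Prop) (ρ : α → β) (l : List α) :
    firstReps r (l.map ρ) = (firstReps (fun a b => r (ρ a) (ρ b)) l).map ρ := by
  classical
  match l with
  | [] => simp [firstReps]
  | x :: l =>
    have := firstReps_map r ρ (l.filter fun y => ¬ r (ρ x) (ρ y))
    simp only [List.map_cons, firstReps, List.filter_map, Function.comp_def]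
    rw [this]
  termination_by l.length
  decreasing_by
    exact Nat.lt_succ_of_le (List.length_filter_le _ _)

theorem firstReps_sublist {α : Type*} (r : α → α → Prop) (l : List α) :
    (firstReps r l).Sublist l := by
  classical
  match l with
  | [] => simp [firstReps]
  | x :: l =>
    rw [firstReps]
    exact ((firstReps_sublist r (l.filter fun y => ¬ r x y)).trans List.filter_sublist).cons_cons x
  termination_by l.length
  decreasing_by
    exact Nat.lt_succ_of_le (List.length_filter_le _ _)

/-- In an increasing list the first elements of the classes are their least elements. -/
theorem mem_firstReps_iff {α : Type*} [LinearOrder α] (r : Setoid α) (l : List α)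
    (hl : l.Pairwise (· < ·)) (y : α) :
    y ∈ firstReps r l ↔ y ∈ l ∧ ∀ z ∈ l, r z y → y ≤ z := by
  classical
  match l with
  | [] => simp [firstReps]
  | x :: l =>
    rw [List.pairwise_cons] at hl
    rw [firstReps, List.mem_cons, mem_firstReps_iff r _ (hl.2.filter _)]
    simp only [List.mem_filter, List.mem_cons, decide_eq_true_eq]
    constructor
    · rintro (rfl | ⟨⟨hy, hxy⟩, h⟩)
      · refine ⟨Or.inl rfl, ?_⟩
        rintro z (rfl | hz) -
        · exact le_rfl
        · exact (hl.1 z hz).le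
      · refine ⟨Or.inr hy, ?_⟩
        rintro z (rfl | hz) hzy
        · exact absurd hzy hxy
        · exact h z ⟨hz, fun hxz => hxy (r.trans hxz hzy)⟩ hzy
    · rintro ⟨rfl | hy, h⟩
      · exact Or.inl rfl
      · refine Or.inr ⟨⟨hy, fun hxy => ?_⟩, fun z hz hzy => h z (Or.inr hz.1) hzy⟩
        exact absurd (h x (Or.inl rfl) hxy) (not_le.2 (hl.1 y hy))
  termination_by l.length
  decreasing_by
    exact Nat.lt_succ_of_le (List.length_filter_le _ _)

theorem gop_eq_firstReps {N : ℕ} (f : Fin N → Fin N) :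
    gop f = (firstReps (componentSetoid f) (List.finRange N)).map (order f) := by
  classical
  have hs : (List.finRange N).Pairwise (· < ·) := List.pairwise_lt_finRange N
  have hs' := hs.sublist (firstReps_sublist (componentSetoid f) (List.finRange N))
  rw [gop]
  congr 1
  refine List.Perm.eq_of_pairwise (le := (· ≤ ·)) ?_ (Finset.pairwise_sort _ _)
    (hs'.imp le_of_lt) ?_
  · intro a b _ _ h1 h2
    exact le_antisymm h1 h2
  rw [List.perm_ext_iff_of_nodup (Finset.sort_nodup _ _) (hs'.imp ne_of_lt)]
  intro y
  rw [mem_firstReps_iff _ _ hs]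
  simp only [Finset.mem_sort, representatives, Finset.mem_filter, Finset.mem_univ, true_and,
    List.mem_finRange, forall_const]
  exact ⟨fun h z hz => h.2 hz, fun h => ⟨(componentSetoid f).refl y, fun z hz => h z hz⟩⟩

open Equiv

/-! ### Permutations with prescribed cycle lengths in order of first visit -/

section perm
variable {V : Type*}

theorem not_sameCycle_of_fixed {σ : Perm V} {x z : V} (h : σ x = x) (hz : z ≠ x) :
    ¬ σ.SameCycle x z := by
  rintro ⟨n, hn⟩
  rw [Perm.zpow_apply_eq_self_of_apply_eq_self h] at hn
  exact hz hn.symm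

/-- A map sending each step of `σ` into a single cycle of `τ` sends each cycle of `σ` into a single
cycle of `τ`. -/
theorem sameCycle_of_forall_apply [Finite V] {W : Type*} {σ : Perm V} {τ : Perm W} (φ : V → W)
    (h : ∀ z, τ.SameCycle (φ z) (φ (σ z))) {z w : V} (hzw : σ.SameCycle z w) :
    τ.SameCycle (φ z) (φ w) := by
  obtain ⟨n, -, rfl⟩ := hzw.exists_pow_eq'
  clear hzw
  induction n with
  | zero => exact Perm.SameCycle.refl _ _
  | succ n ih =>
    rw [pow_succ', Perm.mul_apply]
    exact ih.trans (h _)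

variable [Fintype V] [DecidableEq V]

/-- The length of the cycle of `σ` through `x`; it is `1` for a fixed point. -/
def cycleLen (σ : Perm V) (x : V) : ℕ :=
  (Finset.univ.filter fun y => σ.SameCycle x y).card

/-- The lengths of the cycles of `σ` met by `l`, in order of first visit. -/
noncomputable def cycleLengths (σ : Perm V) (l : List V) : List ℕ :=
  (firstReps σ.SameCycle l).map (cycleLen σ)

/-- The permutations of `V` that fix every point outside `R`. -/
def permsOn (R : Finset V) : Finset (Perm V) :=
  Finset.univ.filter fun σ => ∀ x ∉ R, σ x = x

theorem mem_permsOn {R : Finset V} {σ : Perm V} : σ ∈ permsOn R ↔ ∀ x ∉ R, σ x = x := by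
  simp [permsOn]

/-- Multiplying `σ` by `swap x (σ x)` removes `x` from its cycle and leaves the relation between the
other points as it was. -/
theorem sameCycle_swap_mul (σ : Perm V) {x : V} {z w : V} (hz : z ≠ x) (hw : w ≠ x) :
    (swap x (σ x) * σ).SameCycle z w ↔ σ.SameCycle z w := by
  set σ' := swap x (σ x) * σ with hσ'
  constructor
  · refine sameCycle_of_forall_apply (fun z => z) fun z => ?_
    by_cases h1 : σ z = x
    · have : σ' z = σ (σ z) := by simp [hσ', h1]
      rw [this]
      exact Perm.sameCycle_apply_right.2 (Perm.sameCycle_apply_right.2 (Perm.SameCycle.refl _ _))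
    · by_cases h2 : z = x
      · subst h2
        simp [hσ', Perm.SameCycle.refl]
      · have : σ' z = σ z := by
          simp only [hσ', Perm.mul_apply]
          exact swap_apply_of_ne_of_ne h1 (fun h => h2 (σ.injective h))
        rw [this]
        exact Perm.sameCycle_apply_right.2 (Perm.SameCycle.refl _ _)
  · intro h
    have key := sameCycle_of_forall_apply (σ := σ) (τ := σ')
      (fun z => if z = x then σ x else z) ?_ h
    · simpa [hz, hw] using key
    -- `x` has become a fixed point; its former cycle continues at `σ x`
    intro z
    by_cases h2 : z = x
    · subst h2
      by_cases h3 : σ z = z <;> simp [h3, Perm.SameCycle.refl]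
    · by_cases h1 : σ z = x
      · have : σ' z = σ x := by simp [hσ', h1]
        simp only [h2, h1, if_false, if_true]
        rw [← this]
        exact Perm.sameCycle_apply_right.2 (Perm.SameCycle.refl _ _)
      · have : σ' z = σ z := by
          simp only [hσ', Perm.mul_apply]
          exact swap_apply_of_ne_of_ne h1 (fun h => h2 (σ.injective h))
        simp only [h2, h1, if_false]
        rw [← this]
        exact Perm.sameCycle_apply_right.2 (Perm.SameCycle.refl _ _)

theorem cycleLen_of_fixed {σ : Perm V} {x : V} (h : σ x = x) : cycleLen σ x = 1 := by
  rw [cycleLen, Finset.card_eq_one]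
  refine ⟨x, ?_⟩
  ext z
  simp only [Finset.mem_filter, Finset.mem_univ, true_and, Finset.mem_singleton]
  refine ⟨fun hz => ?_, ?_⟩
  · by_contra hne
    exact not_sameCycle_of_fixed h hne hz
  · rintro rfl; exact Perm.SameCycle.refl _ _

theorem cycleLen_pos (σ : Perm V) (x : V) : 0 < cycleLen σ x := by
  exact Finset.card_pos.2 ⟨x, by simp [Perm.SameCycle.refl]⟩

theorem cycleLengths_cons_of_fixed {σ : Perm V} {x : V} (h : σ x = x) (l : List V) :
    cycleLengths σ (x :: l) = 1 :: cycleLengths σ (l.filter (· ≠ x)) := by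
  simp only [cycleLengths, firstReps_cons, List.map_cons, cycleLen_of_fixed h]
  congr 4
  funext y
  by_cases hy : y = x
  · simp [hy, Perm.SameCycle.refl]
  · simp [hy, not_sameCycle_of_fixed h hy]

/-- Removing a non-fixed first element `x` from its cycle and reading the list from `σ x` instead
lowers the first cycle length by one and changes nothing else. -/
theorem cycleLengths_swap_mul (σ : Perm V) {x : V} (h : σ x ≠ x) (l : List V) :
    ∃ a w, cycleLengths σ (x :: l) = (a + 1) :: w ∧
      cycleLengths (swap x (σ x) * σ) (σ x :: l.filter (· ≠ x)) = a :: w := by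
  set σ' := swap x (σ x) * σ with hσ'
  have hfix : σ' x = x := by simp [hσ']
  have hsame : ∀ z, z ≠ x → (σ'.SameCycle (σ x) z ↔ σ.SameCycle x z) := fun z hz => by
    rw [hσ', sameCycle_swap_mul σ h hz, Perm.sameCycle_apply_left]
  have hx : ¬ σ'.SameCycle (σ x) x := fun hc => not_sameCycle_of_fixed hfix h hc.symm
  refine ⟨cycleLen σ' (σ x), (firstReps σ'.SameCycle
    ((l.filter (· ≠ x)).filter fun y => ¬ σ'.SameCycle (σ x) y)).map (cycleLen σ'), ?_,
    by simp only [cycleLengths, firstReps_cons, List.map_cons]⟩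
  simp only [cycleLengths, firstReps_cons, List.map_cons]
  congr 1
  · rw [cycleLen, cycleLen, ← Finset.card_insert_of_notMem (a := x) (by simpa using hx)]
    congr 1
    ext z
    by_cases hz : z = x
    · simp [hz, Perm.SameCycle.refl]
    · simp [hz, hsame z hz]
  · have e : ((l.filter (· ≠ x)).filter fun y => ¬ σ'.SameCycle (σ x) y) =
        l.filter fun y => ¬ σ.SameCycle x y := by
      rw [List.filter_filter]
      refine List.filter_congr fun y _ => ?_
      by_cases hy : y = x
      · simp [hy, Perm.SameCycle.refl]
      · simp [hy, hsame y hy]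
    rw [e]
    have hne : ∀ z ∈ l.filter (fun y => ¬ σ.SameCycle x y), z ≠ x ∧ ¬ σ.SameCycle x z := by
      intro z hz
      have hz' : ¬ σ.SameCycle x z := by simpa using (List.mem_filter.1 hz).2
      exact ⟨fun hzx => hz' (hzx ▸ Perm.SameCycle.refl _ _), hz'⟩
    rw [firstReps_congr (r := σ.SameCycle) (r' := σ'.SameCycle)]
    · refine List.map_congr_left fun z hz => ?_
      obtain ⟨hz, hz'⟩ := hne z ((firstReps_sublist _ _).subset hz)
      rw [cycleLen, cycleLen]
      congr 1
      ext w
      by_cases hw : w = x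
      · subst hw
        simp only [Finset.mem_filter, Finset.mem_univ, true_and]
        exact ⟨fun hc => absurd hc.symm hz',
          fun hc => absurd hc.symm (not_sameCycle_of_fixed hfix hz)⟩
      · simp [hσ', sameCycle_swap_mul σ hz hw]
    · intro a ha b hb
      rw [hσ', sameCycle_swap_mul σ (hne a ha).1 (hne b hb).1]

/-- The number of permutations of an `ω.sum`-element set whose cycle lengths, in order of first
visit by a list of all its points, are `ω`; see `card_permsOn_cycleLengths`. The recursion removes
the first listed point, whose image is either itself or one of the `a + 1 + w.sum` other points. -/
def cycleCount : List ℕ → ℕ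
  | [] => 1
  | 0 :: _ => 0
  | 1 :: w => cycleCount w
  | (a + 2) :: w => (a + 1 + w.sum) * cycleCount ((a + 1) :: w)
  termination_by w => w.sum + w.length

/-- Removing `x` from its cycle is a bijection from the permutations of `R` that send `x` to `y`
onto the permutations of `R` without `x`. -/
theorem card_permsOn_image (R : Finset V) {x y : V} (hx : x ∈ R) (hy : y ∈ R)
    (P : Perm V → Prop) [DecidablePred P] :
    ((permsOn R).filter fun σ => σ x = y ∧ P (swap x y * σ)).card =
      ((permsOn (R.erase x)).filter P).card := by
  refine Finset.card_nbij' (fun σ => swap x y * σ) (fun σ => swap x y * σ) ?_ ?_ ?_ ?_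
  · intro σ hσ
    simp only [Finset.coe_filter, Set.mem_ofPred_eq, mem_permsOn] at hσ ⊢
    obtain ⟨h1, h2, h3⟩ := hσ
    refine ⟨fun z hz => ?_, h3⟩
    by_cases hzx : z = x
    · simp [hzx, h2]
    · have hzR : z ∉ R := fun h => hz (Finset.mem_erase.2 ⟨hzx, h⟩)
      rw [Perm.mul_apply, h1 z hzR]
      exact swap_apply_of_ne_of_ne hzx (fun h => hzR (h ▸ hy))
  · intro σ hσ
    simp only [Finset.coe_filter, Set.mem_ofPred_eq, mem_permsOn] at hσ ⊢
    obtain ⟨h1, h2⟩ := hσ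
    refine ⟨fun z hz => ?_, ?_, by simpa using h2⟩
    · rw [Perm.mul_apply, h1 z (fun h => hz (Finset.mem_of_mem_erase h))]
      exact swap_apply_of_ne_of_ne (fun h => hz (h ▸ hx)) (fun h => hz (h ▸ hy))
    · simp [Perm.mul_apply, h1 x (by simp)]
  · intro σ _; simp
  · intro σ _; simp

open Classical in
/-- The count depends on neither the order of the list nor its repetitions. This freedom is what
makes the induction work: after removing the head `x` of the list, reading resumes at `σ x`. -/
theorem card_permsOn_cycleLengths (R : Finset V) (l : List V) (hl : ∀ z, z ∈ l ↔ z ∈ R)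
    (ω : List ℕ) :
    ((permsOn R).filter fun σ => cycleLengths σ l = ω).card =
      if R.card = ω.sum then cycleCount ω else 0 := by
  induction hn : R.card generalizing R l ω with
  | zero =>
    have hR : R = ∅ := Finset.card_eq_zero.1 hn
    have hl0 : l = [] := List.eq_nil_iff_forall_not_mem.2 fun z hz => by
      simpa [hR] using (hl z).1 hz
    subst hR hl0
    have hP : permsOn (∅ : Finset V) = {1} := by
      ext σ
      simp [mem_permsOn, Perm.ext_iff]
    rw [hP]
    match ω with
    | [] => simp [cycleLengths, firstReps, cycleCount, Finset.filter_singleton]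
    | 0 :: w => simp [cycleLengths, firstReps, cycleCount]
    | (a + 1) :: w =>
      have : ¬ (0 = a + 1 + w.sum) := by omega
      simp [cycleLengths, firstReps, this]
  | succ n ih =>
    match l with
    | [] =>
      have : R = ∅ := Finset.eq_empty_of_forall_notMem fun z hz => by simpa using (hl z).2 hz
      simp [this] at hn
    | x :: l =>
    have hx : x ∈ R := (hl x).1 (by simp)
    have hRn : (R.erase x).card = n := by rw [Finset.card_erase_of_mem hx, hn]; rfl
    have hl' : ∀ z, z ∈ l.filter (· ≠ x) ↔ z ∈ R.erase x := by
      intro z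
      have := hl z
      simp only [List.mem_cons] at this
      rw [List.mem_filter, Finset.mem_erase, ← this]
      by_cases hz : z = x <;> simp [hz]
    have hfib : ((permsOn R).filter fun σ => cycleLengths σ (x :: l) = ω).card =
        ∑ y ∈ R, ((permsOn R).filter fun σ => σ x = y ∧ cycleLengths σ (x :: l) = ω).card := by
      rw [Finset.card_eq_sum_card_fiberwise (f := fun σ : Perm V => σ x) (t := R)]
      · refine Finset.sum_congr rfl fun y _ => ?_
        rw [Finset.filter_filter]
        congr 1
        ext σ
        simp [and_comm]
      · intro σ hσ
        simp only [Finset.coe_filter, Set.mem_ofPred_eq, mem_permsOn] at hσ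
        by_contra h
        have h1 : σ (σ x) = σ x := hσ.1 _ (by simpa using h)
        exact h (show σ x ∈ R from (σ.injective h1).symm ▸ hx)
    have hfixed : ((permsOn R).filter fun σ => σ x = x ∧ cycleLengths σ (x :: l) = ω).card =
        ((permsOn (R.erase x)).filter fun σ =>
          1 :: cycleLengths σ (l.filter (· ≠ x)) = ω).card := by
      rw [← card_permsOn_image R hx hx]
      congr 1
      refine Finset.filter_congr fun σ _ => and_congr_right fun h => ?_
      rw [cycleLengths_cons_of_fixed h, swap_self]
      rfl
    have hmoved : ∀ y ∈ R.erase x,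
        ((permsOn R).filter fun σ => σ x = y ∧ cycleLengths σ (x :: l) = ω).card =
        ((permsOn (R.erase x)).filter fun σ =>
          ∃ a w, ω = (a + 1) :: w ∧
            cycleLengths σ (y :: l.filter (· ≠ x)) = a :: w).card := by
      intro y hy
      rw [← card_permsOn_image R hx (Finset.mem_of_mem_erase hy)]
      congr 1
      refine Finset.filter_congr fun σ _ => and_congr_right fun h => ?_
      subst h
      obtain ⟨a, w, h1, h2⟩ := cycleLengths_swap_mul σ (Finset.ne_of_mem_erase hy) l
      rw [h1, h2]
      constructor
      · rintro rfl
        exact ⟨a, w, rfl, rfl⟩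
      · rintro ⟨b, v, rfl, h⟩
        simp only [List.cons.injEq] at h
        rw [h.1, h.2]
    have hly : ∀ y ∈ R.erase x, ∀ z, z ∈ y :: l.filter (· ≠ x) ↔ z ∈ R.erase x := by
      intro y hy z
      rw [List.mem_cons, hl']
      exact ⟨fun h => h.elim (fun h => h ▸ hy) id, Or.inr⟩
    have hpos : ∀ σ : Perm V, ∀ y l', ∀ w, cycleLengths σ (y :: l') ≠ 0 :: w := by
      intro σ y l' w h
      simp only [cycleLengths, firstReps_cons, List.map_cons, List.cons.injEq] at h
      exact (cycleLen_pos σ y).ne' h.1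
    rw [hfib, ← Finset.add_sum_erase _ _ hx, hfixed, Finset.sum_congr rfl hmoved]
    match ω with
    | [] => simp
    | 0 :: w => simp [cycleCount]
    | 1 :: w =>
      have h0 : ∀ y ∈ R.erase x, ((permsOn (R.erase x)).filter fun σ =>
          ∃ a v, 1 :: w = (a + 1) :: v ∧
            cycleLengths σ (y :: l.filter (· ≠ x)) = a :: v).card = 0 := by
        intro y _
        rw [Finset.card_eq_zero, Finset.filter_eq_empty_iff]
        rintro σ - ⟨a, v, h1, h2⟩
        simp only [List.cons.injEq] at h1
        obtain rfl : a = 0 := by omega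
        exact hpos _ _ _ _ h2
      rw [Finset.sum_eq_zero h0]
      simp only [List.cons.injEq, true_and, add_zero]
      rw [ih _ _ hl' w hRn, List.sum_cons, cycleCount]
      simp only [Nat.add_comm n 1, Nat.add_left_cancel_iff]
    | (a + 2) :: w =>
      have h0 : ((permsOn (R.erase x)).filter fun σ =>
          1 :: cycleLengths σ (l.filter (· ≠ x)) = (a + 2) :: w).card = 0 := by
        rw [Finset.card_eq_zero, Finset.filter_eq_empty_iff]
        rintro σ - h
        simp only [List.cons.injEq] at h
        omega
      have h1 : ∀ y ∈ R.erase x, ((permsOn (R.erase x)).filter fun σ =>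
          ∃ b v, (a + 2) :: w = (b + 1) :: v ∧
            cycleLengths σ (y :: l.filter (· ≠ x)) = b :: v).card =
          if n = ((a + 1) :: w).sum then cycleCount ((a + 1) :: w) else 0 := by
        intro y hy
        rw [← ih _ _ (hly y hy) ((a + 1) :: w) hRn]
        congr 1
        refine Finset.filter_congr fun σ _ => ?_
        constructor
        · rintro ⟨b, v, h, h'⟩
          simp only [List.cons.injEq] at h
          obtain ⟨h, rfl⟩ := h
          obtain rfl : b = a + 1 := by omega
          exact h'
        · intro h
          exact ⟨a + 1, w, rfl, h⟩
      rw [h0, Finset.sum_congr rfl h1, Finset.sum_const, hRn, cycleCount]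
      rw [smul_eq_mul, zero_add]
      have e1 : ((a + 1) :: w).sum = a + 1 + w.sum := List.sum_cons
      have e2 : ((a + 2) :: w).sum = a + 2 + w.sum := List.sum_cons
      by_cases h : n = a + 1 + w.sum
      · rw [if_pos (h.trans e1.symm), if_pos (by omega), h]
      · rw [if_neg (fun h' => h (h'.trans e1)), if_neg (by omega), mul_zero]

end perm

/-- The product of the sums of all nonempty tails of a list. -/
def tailProd : List ℕ → ℕ
  | [] => 1
  | a :: w => (a + w.sum) * tailProd w

/-- The hypothesis forces all entries of `w` to be positive; both sides then satisfy the same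
recursion when the first entry is lowered by one or, if it is `1`, dropped. -/
theorem cycleCount_mul_tailProd (w : List ℕ) (h : cycleCount w ≠ 0) :
    cycleCount w * tailProd w = w.sum.factorial := by
  match w with
  | [] => simp [cycleCount, tailProd]
  | 0 :: w => simp [cycleCount] at h
  | 1 :: w =>
    rw [cycleCount] at h ⊢
    rw [tailProd, List.sum_cons, add_comm 1, Nat.factorial_succ, ← cycleCount_mul_tailProd w h]
    ring
  | (a + 2) :: w =>
    rw [cycleCount] at h ⊢
    have := cycleCount_mul_tailProd ((a + 1) :: w) (right_ne_zero_of_mul h)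
    rw [List.sum_cons, tailProd] at this
    rw [tailProd, List.sum_cons, show a + 2 + w.sum = (a + 1 + w.sum) + 1 by ring,
      Nat.factorial_succ, ← this]
    ring
  termination_by w.sum + w.length

theorem cycleCount_replicate (m : ℕ) : cycleCount (List.replicate m 1) = 1 := by
  induction m with
  | zero => simp [cycleCount]
  | succ m ih => rw [List.replicate_succ, cycleCount, ih]

/-! ### Rooted forests -/

section forest
variable {V : Type*} [Fintype V] [DecidableEq V]

open Classical in
/-- The rooted forests with root set `R` and non-root vertices `A`, each encoded by its parent map:
roots and all points outside `A` are fixed, and iterating from a point of `A` reaches `R`. -/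
noncomputable def forests (A R : Finset V) : Finset (V → V) :=
  Finset.univ.filter fun g => (∀ x ∉ A, g x = x) ∧ ∀ x ∈ A, ∃ k, g^[k] x ∈ R

theorem mem_forests {A R : Finset V} {g : V → V} :
    g ∈ forests A R ↔ (∀ x ∉ A, g x = x) ∧ ∀ x ∈ A, ∃ k, g^[k] x ∈ R := by
  simp [forests]

/-- Splitting a forest according to the set `S` of children of roots: the parents of the points of
`S` are arbitrary, and what remains is a forest with root set `S`. -/
theorem card_forests_fiber {A R S : Finset V} (hAR : Disjoint A R) (hS : S ⊆ A) :
    ((forests A R).filter fun f => (A.filter fun x => f x ∈ R) = S).card =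
      R.card ^ S.card * (forests (A \ S) S).card := by
  have hpi : (Fintype.piFinset fun x => if x ∈ S then R else {x}).card = R.card ^ S.card := by
    rw [Fintype.card_piFinset]
    simp only [apply_ite Finset.card, Finset.card_singleton]
    rw [Finset.prod_ite_mem, Finset.univ_inter, Finset.prod_const]
  rw [← hpi, ← Finset.card_product]
  refine Finset.card_nbij' (fun f => (fun x => if x ∈ S then f x else x,
      fun x => if x ∈ S then x else f x))
    (fun p x => if x ∈ S then p.1 x else p.2 x) ?_ ?_ ?_ ?_
  · intro f hf
    simp only [Finset.coe_filter, Set.mem_ofPred_eq, mem_forests] at hf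
    obtain ⟨⟨h1, h2⟩, rfl⟩ := hf
    set S := A.filter fun x => f x ∈ R with hSdef
    have hmem : ∀ x, x ∈ S ↔ x ∈ A ∧ f x ∈ R := fun x => by simp [hSdef]
    simp only [Finset.coe_product, Set.mem_prod, Finset.mem_coe, Fintype.mem_piFinset,
      mem_forests]
    refine ⟨fun x => ?_, fun x hx => ?_, fun x hx => ?_⟩
    · by_cases hx : x ∈ S
      · simpa [hx] using ((hmem x).1 hx).2
      · simp [hx]
    · by_cases hxS : x ∈ S
      · simp [hxS]
      · simp only [hxS, if_false]
        exact h1 x fun h => hx (Finset.mem_sdiff.2 ⟨h, hxS⟩)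
    · have hxA := (Finset.mem_sdiff.1 hx).1
      obtain ⟨k, hk⟩ := h2 x hxA
      clear hx
      induction k generalizing x with
      | zero => exact absurd hk (Finset.disjoint_left.1 hAR hxA)
      | succ k ih =>
        by_cases hxS : x ∈ S
        · exact ⟨0, hxS⟩
        have hfx : f x ∉ R := fun h => hxS ((hmem x).2 ⟨hxA, h⟩)
        have hfA : f x ∈ A := by
          by_contra h
          rw [Function.iterate_succ_apply, Function.iterate_fixed (h1 _ h)] at hk
          exact hfx hk
        obtain ⟨j, hj⟩ := ih (f x) hfA (by rwa [Function.iterate_succ_apply] at hk)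
        refine ⟨j + 1, ?_⟩
        rw [Function.iterate_succ_apply, if_neg hxS]
        exact hj
  · rintro ⟨h, g⟩ hp
    simp only [Finset.coe_product, Set.mem_prod, Finset.mem_coe, Fintype.mem_piFinset,
      mem_forests] at hp
    obtain ⟨hh, h1, h2⟩ := hp
    simp only [Finset.coe_filter, Set.mem_ofPred_eq, mem_forests]
    have hhR : ∀ x ∈ S, h x ∈ R := fun x hx => by simpa [hx] using hh x
    refine ⟨⟨fun x hx => ?_, fun x hx => ?_⟩, ?_⟩
    · rw [if_neg fun h => hx (hS h)]
      exact h1 x fun h => hx (Finset.mem_sdiff.1 h).1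
    · by_cases hxS : x ∈ S
      · exact ⟨1, by simpa [hxS] using hhR x hxS⟩
      obtain ⟨k, hk⟩ := h2 x (Finset.mem_sdiff.2 ⟨hx, hxS⟩)
      clear hxS hx
      induction k generalizing x with
      | zero => exact ⟨1, by simpa [show x ∈ S from hk] using hhR x hk⟩
      | succ k ih =>
        by_cases hxS : x ∈ S
        · exact ⟨1, by simpa [hxS] using hhR x hxS⟩
        obtain ⟨j, hj⟩ := ih (g x) (by rwa [Function.iterate_succ_apply] at hk)
        refine ⟨j + 1, ?_⟩
        rw [Function.iterate_succ_apply, if_neg hxS]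
        exact hj
    · ext x
      rw [Finset.mem_filter]
      by_cases hxS : x ∈ S
      · simp [hxS, hS hxS, hhR x hxS]
      · simp only [hxS, if_false, iff_false, not_and]
        intro hxA hgR
        obtain ⟨k, hk⟩ := h2 x (Finset.mem_sdiff.2 ⟨hxA, hxS⟩)
        rcases k with _ | k
        · exact hxS hk
        have hgA : g x ∉ A := fun h => Finset.disjoint_left.1 hAR h hgR
        rw [Function.iterate_succ_apply, Function.iterate_fixed
          (h1 _ fun h => hgA (Finset.mem_sdiff.1 h).1)] at hk
        exact hgA (hS hk)
  · intro f _
    funext x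
    by_cases hx : x ∈ S <;> simp [hx]
  · rintro ⟨h, g⟩ hp
    simp only [Finset.coe_product, Set.mem_prod, Finset.mem_coe, Fintype.mem_piFinset,
      mem_forests] at hp
    obtain ⟨hh, h1, -⟩ := hp
    refine Prod.ext ?_ ?_
    · funext x
      by_cases hx : x ∈ S
      · simp [hx]
      · simpa [hx, eq_comm] using hh x
    · funext x
      by_cases hx : x ∈ S
      · simp [hx, h1 x]
      · simp [hx]

theorem card_forests_eq_sum {A R : Finset V} (hAR : Disjoint A R) :
    (forests A R).card =
      ∑ S ∈ A.powerset, R.card ^ S.card * (forests (A \ S) S).card := by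
  rw [Finset.card_eq_sum_card_fiberwise (f := fun f : V → V => A.filter fun x => f x ∈ R)
    (t := A.powerset) fun f _ =>
      Finset.mem_coe.2 (Finset.mem_powerset.2 (Finset.filter_subset _ _))]
  exact Finset.sum_congr rfl fun S hS => card_forests_fiber hAR (Finset.mem_powerset.1 hS)

theorem sum_choose_mul_pow (m r : ℕ) :
    ∑ k ∈ Finset.range (m + 2), (m + 1).choose k * (r ^ k * (k * (m + 1) ^ (m + 1 - k))) =
      (m + 1) * (r * (m + 1 + r) ^ m) := by
  rw [Finset.sum_range_succ', add_comm (m + 1) r, add_pow r (m + 1) m, Finset.mul_sum,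
    Finset.mul_sum]
  simp only [zero_mul, mul_zero, add_zero]
  refine Finset.sum_congr rfl fun k _ => ?_
  have := Nat.add_one_mul_choose_eq m k
  rw [Nat.add_sub_add_right]
  calc _ = (m + 1).choose (k + 1) * (k + 1) * (r ^ (k + 1) * (m + 1) ^ (m - k)) := by ring
    _ = _ := by rw [← this]; push_cast; ring

/-- Cayley's formula for rooted forests, `|R| * (|A| + |R|) ^ (|A| - 1)`, multiplied by `|A| + |R|`
so that it also covers `A = ∅`. -/
theorem card_forests_mul (A R : Finset V) (hAR : Disjoint A R) :
    (forests A R).card * (A.card + R.card) = R.card * (A.card + R.card) ^ A.card := by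
  induction hn : A.card using Nat.strong_induction_on generalizing A R with
  | _ n ih =>
  rcases n with _ | m
  · have hA : A = ∅ := Finset.card_eq_zero.1 hn
    have : forests A R = {id} := by
      ext g
      simp [mem_forests, hA, funext_iff]
    simp [this]
  have key : ∀ S ∈ A.powerset, (forests (A \ S) S).card * (m + 1) =
      S.card * (m + 1) ^ (m + 1 - S.card) := by
    intro S hS
    rw [Finset.mem_powerset] at hS
    have hc : (A \ S).card = m + 1 - S.card := by rw [Finset.card_sdiff_of_subset hS, hn]
    have hle : S.card ≤ m + 1 := hn ▸ Finset.card_le_card hS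
    rcases S.eq_empty_or_nonempty with rfl | hne
    · obtain ⟨x, hx⟩ : A.Nonempty := Finset.card_pos.1 (by omega)
      have : forests (A \ ∅) (∅ : Finset V) = ∅ :=
        Finset.eq_empty_of_forall_notMem fun g hg => by
          obtain ⟨k, hk⟩ := (mem_forests.1 hg).2 x (by simpa using hx)
          simp at hk
      rw [this]
      simp
    · have hpos := Finset.card_pos.2 hne
      have := ih (m + 1 - S.card) (by omega) (A \ S) S Finset.sdiff_disjoint hc
      rwa [Nat.sub_add_cancel hle] at this
  have h2 : (m + 1) * (forests A R).card = (m + 1) * (R.card * (m + 1 + R.card) ^ m) := by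
    have hsum := Finset.sum_powerset_apply_card
      (fun k => R.card ^ k * (k * (m + 1) ^ (m + 1 - k))) (x := A)
    simp only [hn, smul_eq_mul] at hsum
    rw [card_forests_eq_sum hAR, Finset.mul_sum, ← sum_choose_mul_pow, ← hsum]
    refine Finset.sum_congr rfl fun S hS => ?_
    have := key S hS
    rw [← this]
    ring
  rw [Nat.eq_of_mul_eq_mul_left (Nat.succ_pos m) h2, pow_succ, mul_assoc]

end forest

/-! ### The decomposition of a self-map into a forest and a permutation of the roots -/

/-- The order is constant on components. -/
theorem order_congr {X : Type*} {f : X → X} {x y : X} (h : componentSetoid f x y) :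
    order f x = order f y := by
  have key : ∀ x y : X, componentSetoid f x y → ∀ q,
      (∃ K : ℕ, ∀ k ≥ K, f^[k + q] x = f^[k] x) → ∃ K : ℕ, ∀ k ≥ K, f^[k + q] y = f^[k] y := by
    rintro x y ⟨a, b, h⟩ q ⟨K, hK⟩
    refine ⟨K + b, fun k hk => ?_⟩
    obtain ⟨j, rfl⟩ := Nat.exists_eq_add_of_le hk
    have e : ∀ n, f^[n + b] y = f^[n + a] x := fun n => by
      rw [Function.iterate_add_apply, h, Function.iterate_add_apply]
    rw [show K + b + j + q = (K + j + q) + b by omega, show K + b + j = (K + j) + b by omega,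
      e, e, show K + j + q + a = (K + j + a) + q by omega]
    exact hK _ (by omega)
  unfold order
  congr 1
  ext q
  exact and_congr_right fun _ => ⟨key x y h q, key y x ((componentSetoid f).symm h) q⟩

section decomposition
variable {V : Type*} [Fintype V] [DecidableEq V]

theorem minimalPeriod_eq_cycleLen (σ : Perm V) (x : V) :
    Function.minimalPeriod σ x = cycleLen σ x := by
  have hx : x ∈ Function.periodicPts σ := σ.injective.mem_periodicPts x
  have hlen : ∀ s : Cycle V, s.Nodup → s.toFinset.card = s.length := fun s =>
    Quotient.inductionOn' s fun _ h => List.toFinset_card_of_nodup h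
  have hn := Function.nodup_periodicOrbit (f := σ) (x := x)
  rw [← Function.periodicOrbit_length, ← hlen _ hn, cycleLen]
  congr 1
  ext y
  have hmem : y ∈ (Function.periodicOrbit σ x).toFinset ↔ y ∈ Function.periodicOrbit σ x :=
    List.mem_toFinset
  simp only [hmem, Function.mem_periodicOrbit_iff hx, Finset.mem_filter,
    Finset.mem_univ, true_and]
  constructor
  · rintro ⟨n, rfl⟩
    exact ⟨n, by rw [zpow_natCast, Perm.iterate_eq_pow]⟩
  · intro h
    obtain ⟨n, -, rfl⟩ := h.exists_pow_eq'
    exact ⟨n, by rw [Perm.iterate_eq_pow]⟩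

/-- The map sending each vertex of a forest to its root. -/
theorem exists_root {R : Finset V} {g : V → V} (hg : g ∈ forests Rᶜ R) :
    ∃ ρ : V → V, (∀ x, ρ x ∈ R) ∧ (∀ x ∈ R, ρ x = x) ∧ ∀ x, ρ (g x) = ρ x := by
  obtain ⟨h1, h2⟩ := mem_forests.1 hg
  have hfix : ∀ x ∈ R, g x = x := fun x hx => h1 x (by simpa using hx)
  have hex : ∀ x, ∃ k, g^[k] x ∈ R := fun x => by
    by_cases hx : x ∈ R
    · exact ⟨0, hx⟩
    · exact h2 x (by simpa using hx)
  have huniq : ∀ x i j, g^[i] x ∈ R → g^[j] x ∈ R → g^[i] x = g^[j] x := by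
    intro x i j hi hj
    rw [← Function.iterate_fixed (hfix _ hi) j, ← Function.iterate_add_apply, add_comm,
      Function.iterate_add_apply, Function.iterate_fixed (hfix _ hj) i]
  choose k hk using hex
  refine ⟨fun x => g^[k x] x, hk, fun x hx => Function.iterate_fixed (hfix x hx) _, fun x => ?_⟩
  have := hk (g x)
  rw [← Function.iterate_succ_apply] at this
  exact huniq x _ _ this (hk x)

variable {R : Finset V} {g : V → V} {σ : Perm V}

theorem apply_mem_iff_of_mem_permsOn (hσ : σ ∈ permsOn R) {x : V} : σ x ∈ R ↔ x ∈ R := by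
  rw [mem_permsOn] at hσ
  constructor
  · intro h
    by_contra hx
    exact hx (hσ x hx ▸ h)
  · intro hx
    by_contra h
    exact h ((σ.injective (hσ _ h)).symm ▸ hx)

/-- On the roots, `σ ∘ g` acts as `σ`. -/
theorem iterate_comp (hg : g ∈ forests Rᶜ R) (hσ : σ ∈ permsOn R) {x : V} (hx : x ∈ R) (n : ℕ) :
    (σ ∘ g)^[n] x = (σ ^ n) x ∧ (σ ^ n) x ∈ R := by
  induction n with
  | zero => simpa using hx
  | succ n ih =>
    rw [Function.iterate_succ_apply', ih.1, pow_succ', Perm.mul_apply,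
      apply_mem_iff_of_mem_permsOn hσ]
    refine ⟨?_, ih.2⟩
    rw [Function.comp_apply, (mem_forests.1 hg).1 _ (by simpa using ih.2)]

theorem componentSetoid_root (hg : g ∈ forests Rᶜ R) (hσ : σ ∈ permsOn R) {ρ : V → V}
    (hρR : ∀ x ∈ R, ρ x = x) (hρg : ∀ x, ρ (g x) = ρ x) (x : V) :
    componentSetoid (σ ∘ g) x (ρ x) := by
  have hstep : ∀ z, componentSetoid (σ ∘ g) z ((σ ∘ g) z) := fun z => ⟨1, 0, rfl⟩
  by_cases hx : x ∈ R
  · rw [hρR x hx]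
  obtain ⟨k, hk⟩ := (mem_forests.1 hg).2 x (by simpa using hx)
  clear hx
  induction k generalizing x with
  | zero => rw [hρR x hk]
  | succ k ih =>
    rw [Function.iterate_succ_apply] at hk
    have h1 := ih (g x) hk
    rw [hρg] at h1
    refine (componentSetoid _).trans (hstep x) ?_
    by_cases hgx : g x ∈ R
    · have e : (σ ∘ g) x = (σ ∘ g) (ρ x) := by
        rw [← hρg x, hρR _ hgx, Function.comp_apply, Function.comp_apply,
          (mem_forests.1 hg).1 (g x) (by simpa using hgx)]
      rw [e]
      exact (componentSetoid _).symm (hstep _)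
    · rwa [Function.comp_apply, mem_permsOn.1 hσ _ hgx]

/-- Two points lie in the same component of `σ ∘ g` exactly when their roots lie in the same cycle
of `σ`. -/
theorem componentSetoid_comp_iff (hg : g ∈ forests Rᶜ R) (hσ : σ ∈ permsOn R) {ρ : V → V}
    (hρ : ∀ x, ρ x ∈ R) (hρR : ∀ x ∈ R, ρ x = x) (hρg : ∀ x, ρ (g x) = ρ x) (x y : V) :
    componentSetoid (σ ∘ g) x y ↔ σ.SameCycle (ρ x) (ρ y) := by
  constructor
  · have hstep : ∀ z n, σ.SameCycle (ρ z) (ρ ((σ ∘ g)^[n] z)) := by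
      intro z n
      induction n with
      | zero => exact Perm.SameCycle.refl _ _
      | succ n ih =>
        rw [Function.iterate_succ_apply']
        refine ih.trans ?_
        generalize (σ ∘ g)^[n] z = w
        by_cases hw : g w ∈ R
        · rw [Function.comp_apply, hρR _ ((apply_mem_iff_of_mem_permsOn hσ).2 hw),
            ← hρg w, hρR _ hw]
          exact Perm.sameCycle_apply_right.2 (Perm.SameCycle.refl _ _)
        · rw [Function.comp_apply, mem_permsOn.1 hσ _ hw, hρg]
    rintro ⟨k, i, h⟩
    exact (h ▸ hstep x k).trans (hstep y i).symm
  · intro h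
    obtain ⟨n, -, hn⟩ := h.exists_pow_eq'
    refine (componentSetoid _).trans (componentSetoid_root hg hσ hρR hρg x)
      ((componentSetoid _).trans ⟨n, 0, ?_⟩
        ((componentSetoid _).symm (componentSetoid_root hg hσ hρR hρg y)))
    rw [(iterate_comp hg hσ (hρ x) n).1, hn]
    rfl

theorem order_comp (hg : g ∈ forests Rᶜ R) (hσ : σ ∈ permsOn R) {ρ : V → V}
    (hρ : ∀ x, ρ x ∈ R) (hρR : ∀ x ∈ R, ρ x = x) (hρg : ∀ x, ρ (g x) = ρ x) (x : V) :
    order (σ ∘ g) x = cycleLen σ (ρ x) := by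
  rw [order_congr (componentSetoid_root hg hσ hρR hρg x), ← minimalPeriod_eq_cycleLen]
  have hpos : 0 < Function.minimalPeriod σ (ρ x) :=
    Function.minimalPeriod_pos_of_mem_periodicPts (σ.injective.mem_periodicPts _)
  have hmem : ∀ q, (∃ K : ℕ, ∀ k ≥ K, (σ ∘ g)^[k + q] (ρ x) = (σ ∘ g)^[k] (ρ x)) ↔
      Function.IsPeriodicPt σ q (ρ x) := by
    intro q
    simp only [(iterate_comp hg hσ (hρ x) _).1, pow_add, Perm.mul_apply,
      EmbeddingLike.apply_eq_iff_eq]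
    rw [Function.IsPeriodicPt, Function.IsFixedPt, Perm.iterate_eq_pow]
    exact ⟨fun ⟨K, h⟩ => h K le_rfl, fun h => ⟨0, fun _ _ => h⟩⟩
  unfold order
  simp only [hmem]
  refine le_antisymm (Nat.sInf_le ⟨hpos, Function.isPeriodicPt_minimalPeriod _ _⟩) ?_
  refine le_csInf ⟨_, hpos, Function.isPeriodicPt_minimalPeriod _ _⟩ ?_
  rintro q ⟨hq, h⟩
  exact h.minimalPeriod_le hq

theorem mem_periodicPts_comp_iff (hg : g ∈ forests Rᶜ R) (hσ : σ ∈ permsOn R) (x : V) :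
    x ∈ Function.periodicPts (σ ∘ g) ↔ x ∈ R := by
  constructor
  · intro hx
    obtain ⟨ρ, hρ, hρR, hρg⟩ := exists_root hg
    obtain ⟨a, b, h⟩ := componentSetoid_root hg hσ hρR hρg x
    have hmem : (σ ∘ g)^[a] x ∈ R := by
      rw [← h, (iterate_comp hg hσ (hρ x) b).1]
      exact (iterate_comp hg hσ (hρ x) b).2
    obtain ⟨n, hn, hp⟩ := hx
    have h2 : (σ ∘ g)^[n * a] x = x := hp.mul_const a
    have hle : a ≤ n * a := Nat.le_mul_of_pos_left a hn
    rw [← h2, ← Nat.sub_add_cancel hle, Function.iterate_add_apply,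
      (iterate_comp hg hσ hmem _).1]
    exact (iterate_comp hg hσ hmem _).2
  · intro hx
    obtain ⟨n, hn, h⟩ := σ.injective.mem_periodicPts x
    refine ⟨n, hn, ?_⟩
    rw [Function.IsPeriodicPt, Function.IsFixedPt, Perm.iterate_eq_pow] at h
    rw [Function.IsPeriodicPt, Function.IsFixedPt, (iterate_comp hg hσ hx n).1, h]

/-- Every self-map is a forest followed by a permutation of the roots: the roots are the periodic
points and the permutation is the restriction of `f` to them. -/
theorem exists_comp_eq (f : V → V) :
    ∃ R : Finset V, ∃ g ∈ forests Rᶜ R, ∃ σ ∈ permsOn R, (σ ∘ g) = f := by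
  classical
  set P := Function.periodicPts f with hP
  have hbij : Function.Bijective ((Function.bijOn_periodicPts f).mapsTo.restrict f P P) :=
    (Function.bijOn_periodicPts f).bijective
  let σ : Perm V := Perm.ofSubtype (Equiv.ofBijective _ hbij)
  have hσP : ∀ x ∈ P, σ x = f x := fun x hx => by
    rw [Perm.ofSubtype_apply_of_mem _ hx]
    rfl
  have hσ : σ ∈ permsOn P.toFinset := mem_permsOn.2 fun x hx =>
    Perm.ofSubtype_apply_of_not_mem _ (by simpa using hx)
  refine ⟨P.toFinset, fun x => σ⁻¹ (f x), mem_forests.2 ⟨fun x hx => ?_, fun x hxc => ?_⟩,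
    σ, hσ, ?_⟩
  · rw [Perm.inv_eq_iff_eq, hσP x (by simpa using hx)]
  · clear hxc
    obtain ⟨k, hk⟩ : ∃ k, f^[k] x ∈ P := by
      obtain ⟨i, j, hij, h⟩ := Finite.exists_ne_map_eq_of_infinite fun n => f^[n] x
      wlog hlt : i < j generalizing i j
      · exact this j i hij.symm h.symm (lt_of_le_of_ne (not_lt.1 hlt) hij.symm)
      refine ⟨i, j - i, Nat.sub_pos_of_lt hlt, ?_⟩
      rw [Function.IsPeriodicPt, Function.IsFixedPt, ← Function.iterate_add_apply,
        Nat.sub_add_cancel hlt.le]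
      exact h.symm
    induction k generalizing x with
    | zero => exact ⟨0, by simpa using hk⟩
    | succ k ih =>
      by_cases hfx : f x ∈ P
      · refine ⟨1, (apply_mem_iff_of_mem_permsOn hσ).1 ?_⟩
        simpa using hfx
      · obtain ⟨j, hj⟩ := ih (f x) (by rwa [Function.iterate_succ_apply] at hk)
        refine ⟨j + 1, ?_⟩
        rw [Function.iterate_succ_apply,
          Perm.inv_eq_iff_eq.2 (mem_permsOn.1 hσ (f x) (by simpa using hfx)).symm]
        exact hj
  · funext x
    simp

/-- The decomposition is unique, since the root set is the set of periodic points. -/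
theorem comp_injective {R' : Finset V} {g' : V → V} {σ' : Perm V}
    (hg : g ∈ forests Rᶜ R) (hσ : σ ∈ permsOn R)
    (hg' : g' ∈ forests R'ᶜ R') (hσ' : σ' ∈ permsOn R') (h : σ ∘ g = σ' ∘ g') :
    R = R' ∧ g = g' ∧ σ = σ' := by
  have hR : R = R' := by
    ext x
    rw [← mem_periodicPts_comp_iff hg hσ, h, mem_periodicPts_comp_iff hg' hσ']
  subst hR
  have hs : σ = σ' := by
    ext x
    by_cases hx : x ∈ R
    · have := congrFun h x
      rwa [Function.comp_apply, Function.comp_apply, (mem_forests.1 hg).1 x (by simpa using hx),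
        (mem_forests.1 hg').1 x (by simpa using hx)] at this
    · rw [mem_permsOn.1 hσ x hx, mem_permsOn.1 hσ' x hx]
  subst hs
  exact ⟨rfl, funext fun x => σ.injective (congrFun h x), rfl⟩

end decomposition

/-! ### Counting the maps with a given global orbit pattern -/

/-- The global orbit pattern of `σ ∘ g` lists the cycle lengths of `σ` in order of first visit by
the roots of `0, 1, …, N - 1`. -/
theorem gop_comp {N : ℕ} {R : Finset (Fin N)} {g ρ : Fin N → Fin N} {σ : Perm (Fin N)}
    (hg : g ∈ forests Rᶜ R) (hσ : σ ∈ permsOn R)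
    (hρ : ∀ x, ρ x ∈ R) (hρR : ∀ x ∈ R, ρ x = x) (hρg : ∀ x, ρ (g x) = ρ x) :
    gop (σ ∘ g) = cycleLengths σ ((List.finRange N).map ρ) := by
  rw [gop_eq_firstReps, cycleLengths, firstReps_map, List.map_map]
  rw [firstReps_congr (r' := fun a b => σ.SameCycle (ρ a) (ρ b)) _ fun a _ b _ =>
    componentSetoid_comp_iff hg hσ hρ hρR hρg a b]
  exact List.map_congr_left fun x _ => order_comp hg hσ hρ hρR hρg x

open Classical in
/-- Over a fixed forest, the number of permutations of the roots that produce the pattern `ω` does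
not depend on the forest. -/
theorem card_permsOn_gop {N : ℕ} {R : Finset (Fin N)} {g : Fin N → Fin N}
    (hg : g ∈ forests Rᶜ R) (ω : List ℕ) :
    ((permsOn R).filter fun σ : Perm (Fin N) => gop (σ ∘ g) = ω).card =
      if R.card = ω.sum then cycleCount ω else 0 := by
  obtain ⟨ρ, hρ, hρR, hρg⟩ := exists_root hg
  rw [← card_permsOn_cycleLengths R ((List.finRange N).map ρ)]
  · congr 1
    ext σ
    simp only [Finset.mem_filter]
    exact and_congr_right fun hσ => by rw [gop_comp hg hσ hρ hρR hρg]
  · intro z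
    simp only [List.mem_map, List.mem_finRange, true_and]
    exact ⟨fun ⟨a, h⟩ => h ▸ hρ a, fun h => ⟨z, hρR z h⟩⟩

theorem ncard_gopClass (N : ℕ) (ω : List ℕ) :
    (gopClass N ω).ncard =
      ∑ R ∈ Finset.powersetCard ω.sum (Finset.univ : Finset (Fin N)),
        (forests Rᶜ R).card * cycleCount ω := by
  classical
  have hset : gopClass N ω = ((Finset.univ.filter fun f : Fin N → Fin N => gop f = ω :
      Finset (Fin N → Fin N)) : Set (Fin N → Fin N)) := by
    ext f
    simp [gopClass]
  rw [hset, Set.ncard_coe_finset]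
  have hbij : (Finset.univ.filter fun f : Fin N → Fin N => gop f = ω).card =
      ((Finset.univ : Finset (Finset (Fin N))).sigma fun R => (forests Rᶜ R).sigma fun g =>
        (permsOn R).filter fun σ : Perm (Fin N) => gop (σ ∘ g) = ω).card := by
    symm
    refine Finset.card_bij (fun p _ => p.2.2 ∘ p.2.1) ?_ ?_ ?_
    · rintro ⟨R, g, σ⟩ h
      simp only [Finset.mem_sigma, Finset.mem_filter] at h
      simpa using h.2.2.2
    · rintro ⟨R, g, σ⟩ h ⟨R', g', σ'⟩ h' heq
      simp only [Finset.mem_sigma, Finset.mem_filter] at h h'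
      replace heq : σ ∘ g = σ' ∘ g' := heq
      obtain ⟨rfl, rfl, rfl⟩ :=
        comp_injective (R := R) (g := g) (σ := σ) (R' := R') (g' := g') (σ' := σ')
          h.2.1 h.2.2.1 h'.2.1 h'.2.2.1 heq
      rfl
    · intro f hf
      obtain ⟨R, g, hg, σ, hσ, rfl⟩ := exists_comp_eq f
      exact ⟨⟨R, g, σ⟩, by simpa [hg, hσ] using hf, rfl⟩
  rw [hbij, Finset.card_sigma, ← Finset.powerset_univ, Finset.powersetCard_eq_filter,
    Finset.sum_filter]
  refine Finset.sum_congr rfl fun R _ => ?_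
  rw [Finset.card_sigma, Finset.sum_congr rfl fun g hg => card_permsOn_gop hg ω,
    Finset.sum_const, smul_eq_mul, mul_ite, mul_zero]

theorem ncard_gopClass_mul (N : ℕ) (ω : List ℕ) :
    (gopClass N ω).ncard * N = N.choose ω.sum * ω.sum * N ^ (N - ω.sum) * cycleCount ω := by
  have : ∀ R ∈ Finset.powersetCard ω.sum (Finset.univ : Finset (Fin N)),
      (forests Rᶜ R).card * cycleCount ω * N = ω.sum * N ^ (N - ω.sum) * cycleCount ω := by
    intro R hR
    have hR := (Finset.mem_powersetCard.1 hR).2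
    have h := card_forests_mul Rᶜ R disjoint_compl_left
    rw [Finset.card_compl_add_card, Finset.card_compl, Fintype.card_fin, hR] at h
    rw [mul_right_comm, h]
  rw [ncard_gopClass, Finset.sum_mul, Finset.sum_congr rfl this, Finset.sum_const,
    Finset.card_powersetCard, Finset.card_univ, Fintype.card_fin, smul_eq_mul]
  ring

theorem tailProd_ofFn {p : ℕ} (ω : Fin p → ℕ) :
    tailProd (List.ofFn ω) = ∏ k, ∑ j ∈ Finset.Ici k, ω j := by
  induction p with
  | zero => simp [tailProd]
  | succ p ih =>
    rw [List.ofFn_succ, tailProd, ih, Fin.prod_univ_succ, List.sum_ofFn]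
    congr 1
    · rw [← Fin.sum_univ_succ]
      congr 1
      ext j
      simp
    · refine Finset.prod_congr rfl fun k _ => ?_
      rw [← Fin.map_succEmb_Ici, Finset.sum_map]
      rfl

end GlobalOrbitPattern

open GlobalOrbitPattern in
theorem theorem7 (N p : ℕ) (hp : 2 ≤ p) (ω : Fin p → ℕ)
    (hω : List.ofFn ω ∈ GlobalOrbitPattern.gops N) :
    ((GlobalOrbitPattern.gopClass N (List.ofFn ω)).ncard : ℚ) =
        ((GlobalOrbitPattern.gopClass N (List.replicate (∑ i, ω i) 1)).ncard : ℚ) *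
          ((Nat.factorial ((∑ i, ω i) - 1) : ℚ) /
            ∏ k ∈ Finset.univ.filter (fun k : Fin p => 1 ≤ (k : ℕ)), ∑ j ∈ Finset.Ici k, (ω j : ℚ)) ∧
      ((GlobalOrbitPattern.gopClass N (List.ofFn ω)).ncard : ℚ) =
        ((Nat.factorial (N - 1) : ℚ) * (N : ℚ) ^ (N - ∑ i, ω i)) /
          ((Nat.factorial (N - ∑ i, ω i) : ℚ) *
            ∏ k ∈ Finset.univ.filter (fun k : Fin p => 1 ≤ (k : ℕ)), ∑ j ∈ Finset.Ici k, (ω j : ℚ)) := by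
  obtain ⟨q, rfl⟩ : ∃ q, p = q + 1 := ⟨p - 1, by omega⟩
  set m := ∑ i, ω i with hm
  have hsum : (List.ofFn ω).sum = m := List.sum_ofFn
  set T : ℕ := ∏ k ∈ Finset.univ.filter (fun k : Fin (q + 1) => 1 ≤ (k : ℕ)),
    ∑ j ∈ Finset.Ici k, ω j with hT
  have hTcast : (∏ k ∈ Finset.univ.filter (fun k : Fin (q + 1) => 1 ≤ (k : ℕ)),
      ∑ j ∈ Finset.Ici k, (ω j : ℚ)) = (T : ℚ) := by
    rw [hT]; push_cast; rfl
  have htail : tailProd (List.ofFn ω) = m * T := by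
    have : (Finset.univ.filter fun k : Fin (q + 1) => 1 ≤ (k : ℕ)) = Finset.univ.erase 0 := by
      ext k
      rw [Finset.mem_filter, Finset.mem_erase, and_comm, Nat.one_le_iff_ne_zero,
        Fin.val_ne_zero_iff]
    rw [tailProd_ofFn, hT, this, ← Finset.mul_prod_erase _ _ (Finset.mem_univ (0 : Fin (q + 1)))]
    congr 1
    rw [hm]
    congr 1
    ext j
    simp
  have hN : (gopClass N (List.ofFn ω)).ncard ≠ 0 := by
    obtain ⟨f, hf⟩ := hω
    exact ((Set.ncard_pos (Set.toFinite _)).2 ⟨f, hf⟩).ne'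
  have hD := ncard_gopClass_mul N (List.ofFn ω)
  have hE := ncard_gopClass_mul N (List.replicate m 1)
  rw [hsum] at hD
  rw [cycleCount_replicate, List.sum_replicate, smul_eq_mul, mul_one, mul_one] at hE
  have hN0 : N ≠ 0 := by
    rintro rfl
    obtain ⟨f, hf⟩ := hω
    have hrep : representatives f = ∅ := Finset.eq_empty_of_isEmpty _
    simp [gop, hrep] at hf
  have hprod := hD ▸ mul_ne_zero hN hN0
  have hc : cycleCount (List.ofFn ω) ≠ 0 := right_ne_zero_of_mul hprod
  have hm0 : m ≠ 0 := right_ne_zero_of_mul (left_ne_zero_of_mul (left_ne_zero_of_mul hprod))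
  -- the pattern is realized, so every factor of the count is nonzero
  have hmN : m ≤ N := by
    by_contra h
    rw [Nat.choose_eq_zero_of_lt (not_le.1 h)] at hprod
    simp at hprod
  have hcT : cycleCount (List.ofFn ω) * T = (m - 1).factorial := by
    have h := cycleCount_mul_tailProd _ hc
    rw [htail, hsum, ← Nat.mul_factorial_pred hm0, mul_left_comm] at h
    exact Nat.eq_of_mul_eq_mul_left (Nat.pos_of_ne_zero hm0) h
  have hT0 : T ≠ 0 := right_ne_zero_of_mul (hcT ▸ Nat.factorial_ne_zero _)
  have hDE : (gopClass N (List.ofFn ω)).ncard =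
      (gopClass N (List.replicate m 1)).ncard * cycleCount (List.ofFn ω) := by
    refine Nat.eq_of_mul_eq_mul_right (Nat.pos_of_ne_zero hN0) ?_
    rw [hD, mul_right_comm _ _ N, hE]
  have hcount : (gopClass N (List.ofFn ω)).ncard * ((N - m).factorial * T) =
      (N - 1).factorial * N ^ (N - m) := by
    refine Nat.eq_of_mul_eq_mul_left (Nat.pos_of_ne_zero hN0) ?_
    calc _ = (gopClass N (List.ofFn ω)).ncard * N * ((N - m).factorial * T) := by ring
      _ = N.choose m * (m * (cycleCount (List.ofFn ω) * T)) * (N - m).factorial *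
          N ^ (N - m) := by rw [hD]; ring
      _ = _ := by
        rw [hcT, Nat.mul_factorial_pred hm0, Nat.choose_mul_factorial_mul_factorial hmN,
          ← mul_assoc, Nat.mul_factorial_pred hN0]
  have hTQ : (T : ℚ) ≠ 0 := Nat.cast_ne_zero.2 hT0
  rw [hTcast]
  constructor
  · rw [← hcT, hDE]
    push_cast
    rw [mul_div_cancel_right₀ _ hTQ]
  · rw [eq_div_iff (mul_ne_zero (Nat.cast_ne_zero.2 (Nat.factorial_ne_zero _)) hTQ)]
    exact_mod_cast hcount
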